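/- Let $n \ge 0$ be an integer and $[n]=\{1,\dots,n\}$. For a complex $n\times n$ matrix $A$ and $I\subseteq[n]$ let $A_I$ denote the principal minor of $A$ with rows and columns indexed by $I$, where $A_\emptyset = 1$. The affine principal minor map is $$\phi_a:\mathbb{C}^{n\times n}\to\mathbb{C}^{2^n},\qquad A\mapsto (A_I)_{I\subseteq[n]}.$$ Then the image of $\phi_a$ is closed in $\mathbb{C}^{2^n}$, both in the Euclidean topology and in the Zariski topology; that is, it is a Euclidean-closed set and it is the common zero set of a family of polynomials in $2^n$ variables with complex coefficients. -/

import Mathlib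

/-- The affine principal minor map: it sends a complex `n × n` matrix `A` to the vector, indexed by
the subsets `I` of the index set, of the determinants of the submatrices of `A` with rows and
columns in `I`. The minor for `I = ∅` is the determinant of the empty matrix, which is `1`. -/
def affinePrincipalMinorMap (n : ℕ) (A : Matrix (Fin n) (Fin n) ℂ) : Finset (Fin n) → ℂ :=
  fun I => (A.submatrix (Subtype.val : I → Fin n) (Subtype.val : I → Fin n)).det

/-! The torus of diagonal matrices acts by conjugation and fixes every principal minor. If all
minors of positive size vanish at a matrix, so does every nonconstant invariant monomial: otherwise
its support digraph contains a cycle, and a minimal successor-closed vertex set gives a minor with a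
single nonzero Leibniz term. By the Nullstellensatz and a graded induction, the invariant ring is a
finite module over the polynomials in the minors (`fg_invariants`). Projection to weight zero and
Nakayama then show that every point of the Zariski closure has a nonempty fibre
(`one_notMem_map_minorHom`). -/

/-- If every vertex of a nonempty finite set has an `r`-successor in the set, then on some nonempty
subset the relation `r` is the graph of a permutation. -/
theorem exists_finset_perm_graph {α : Type*} [DecidableEq α] (r : α → α → Prop) (s : Finset α)
    (hs : s.Nonempty) (h : ∀ i ∈ s, ∃ j ∈ s, r i j) :
    ∃ t : Finset α, t.Nonempty ∧ ∃ σ : Equiv.Perm t, ∀ i j : t, r i j ↔ j = σ i := by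
  induction s using Finset.strongInduction with
  | H s ih =>
  by_cases hmin : ∃ t, t ⊂ s ∧ t.Nonempty ∧ ∀ i ∈ t, ∃ j ∈ t, r i j
  · obtain ⟨t, hts, ht, hc⟩ := hmin
    exact ih t hts ht hc
  -- By minimality of `s`: the image of a successor function is again closed under successors.
  have surj : ∀ g : s → s, (∀ i : s, r i (g i)) → Function.Surjective g := by
    intro g hg
    by_contra hns
    obtain ⟨j, hj⟩ := not_forall.mp hns
    refine hmin ⟨Finset.univ.image fun i => (g i : α), ?_, ?_, ?_⟩
    · refine Finset.ssubset_iff_subset_ne.mpr ⟨?_, fun heq => hj ?_⟩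
      · intro x hx
        obtain ⟨i, -, rfl⟩ := Finset.mem_image.mp hx
        exact (g i).2
      · have hjm : (j : α) ∈ Finset.univ.image fun i => (g i : α) := by rw [heq]; exact j.2
        obtain ⟨i, -, hi⟩ := Finset.mem_image.mp hjm
        exact ⟨i, Subtype.ext hi⟩
    · obtain ⟨i, hi⟩ := hs
      exact ⟨g ⟨i, hi⟩, Finset.mem_image_of_mem _ (Finset.mem_univ _)⟩
    · intro x hx
      obtain ⟨i, -, rfl⟩ := Finset.mem_image.mp hx
      exact ⟨g (g i), Finset.mem_image_of_mem _ (Finset.mem_univ _), hg _⟩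
  have hex : ∀ i : s, ∃ j : s, r i j := fun i =>
    let ⟨j, hj, hr⟩ := h i i.2
    ⟨⟨j, hj⟩, hr⟩
  choose f hf using hex
  have hbij : Function.Bijective f := Finite.surjective_iff_bijective.mp (surj f hf)
  refine ⟨s, hs, Equiv.ofBijective f hbij, fun i j => ⟨fun hij => ?_, ?_⟩⟩
  · by_contra hne
    -- Redirecting `i` to a second successor `j` would leave `f i` without a preimage.
    obtain ⟨k, hk⟩ := surj (Function.update f i j) (fun k : s => by
      by_cases hki : k = i
      · subst hki; simpa using hij
      · simpa [Function.update_of_ne hki] using hf k) (f i)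
    by_cases hki : k = i
    · subst hki
      rw [Function.update_self] at hk
      exact hne hk
    · rw [Function.update_of_ne hki] at hk
      exact hki (hbij.1 hk)
  · rintro rfl
    exact hf i

theorem Matrix.det_ne_zero_of_support_eq_graph {ι R : Type*} [Fintype ι] [DecidableEq ι]
    [CommRing R] [IsDomain R] (M : Matrix ι ι R) (σ : Equiv.Perm ι)
    (h : ∀ i j, M i j ≠ 0 ↔ j = σ i) : M.det ≠ 0 := by
  rw [← Matrix.det_transpose, Matrix.det_apply, Finset.sum_eq_single σ]
  · rw [Units.smul_def, ← Int.cast_smul_eq_zsmul R, smul_eq_mul]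
    refine mul_ne_zero ?_ (Finset.prod_ne_zero_iff.mpr fun i _ => (h i (σ i)).mpr rfl)
    rcases Int.units_eq_one_or (Equiv.Perm.sign σ) with hs | hs <;> simp [hs]
  · intro τ _ hτ
    obtain ⟨i, hi⟩ := not_forall.mp (fun hall => hτ (Equiv.ext hall) : ¬ ∀ i, τ i = σ i)
    rw [Finset.prod_eq_zero (Finset.mem_univ i), smul_zero]
    by_contra hne
    exact hi ((h i (τ i)).mp hne)
  · simp

namespace PrincipalMinor

open MvPolynomial

variable {n : ℕ}

/-! ### Torus weights and cycles -/

/-- The weight of the matrix entry `(i, j)` under the torus acting by diagonal conjugation. -/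
def torusWeight (n : ℕ) (e : Fin n × Fin n) : Fin n → ℤ :=
  Pi.single e.1 1 - Pi.single e.2 1

/-- The torus weight together with the degree. -/
def gradedTorusWeight (n : ℕ) (e : Fin n × Fin n) : (Fin n → ℤ) × ℤ :=
  (torusWeight n e, 1)

theorem weight_gradedTorusWeight (m : Fin n × Fin n →₀ ℕ) :
    Finsupp.weight (gradedTorusWeight n) m =
      (Finsupp.weight (torusWeight n) m, (m.degree : ℤ)) := by
  induction m using Finsupp.induction_linear with
  | zero => simp [Prod.ext_iff]
  | add f g hf hg => rw [map_add, map_add, map_add, hf, hg]; simp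
  | single e c => simp [Finsupp.weight_apply, gradedTorusWeight]

/-- Weight zero means that in-degree equals out-degree at each vertex of the multigraph `m`. -/
theorem exists_out_edge {m : Fin n × Fin n →₀ ℕ} (hm : Finsupp.weight (torusWeight n) m = 0)
    {i j : Fin n} (hij : m (i, j) ≠ 0) : ∃ k, m (j, k) ≠ 0 := by
  by_contra! hno
  have hne : i ≠ j := by rintro rfl; exact hij (hno i)
  have h0 := congrFun hm j
  rw [Finsupp.weight_apply, Finsupp.sum_fintype _ _ (by simp), Finset.sum_apply] at h0
  refine absurd h0 (ne_of_lt (Finset.sum_neg' (fun e _ => ?_) ⟨(i, j), Finset.mem_univ _, ?_⟩))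
  · obtain ⟨a, b⟩ := e
    by_cases ha : j = a
    · subst ha; simp [hno b]
    · rw [Pi.smul_apply, torusWeight, Pi.sub_apply, Pi.single_eq_of_ne ha, zero_sub]
      by_cases hb : j = b
      · subst hb; simp
      · simp [hb]
  · simp [torusWeight, hne.symm]
    omega

theorem exists_finset_perm_graph_of_weight_eq_zero {m : Fin n × Fin n →₀ ℕ}
    (hm : Finsupp.weight (torusWeight n) m = 0) (hm0 : m ≠ 0) (r : Fin n → Fin n → Prop)
    (hr : ∀ i j, m (i, j) ≠ 0 → r i j) :
    ∃ t : Finset (Fin n), t.Nonempty ∧ ∃ σ : Equiv.Perm t, ∀ i j : t, r i j ↔ j = σ i := by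
  classical
  refine exists_finset_perm_graph r (Finset.univ.filter fun i => ∃ j, m (i, j) ≠ 0) ?_ ?_
  · obtain ⟨⟨i, j⟩, hij⟩ := Finsupp.ne_iff.mp hm0
    exact ⟨i, by simpa using ⟨j, hij⟩⟩
  · intro i hi
    obtain ⟨j, hij⟩ := (Finset.mem_filter.mp hi).2
    exact ⟨j, by simpa using exists_out_edge hm hij, hr i j hij⟩

theorem exists_le_degree_le {m : Fin n × Fin n →₀ ℕ}
    (hm : Finsupp.weight (torusWeight n) m = 0) (hm0 : m ≠ 0) :
    ∃ c ≤ m, c ≠ 0 ∧ Finsupp.weight (torusWeight n) c = 0 ∧ c.degree ≤ n := by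
  classical
  obtain ⟨t, ht, σ, hσ⟩ := exists_finset_perm_graph_of_weight_eq_zero hm hm0
    (fun i j => m (i, j) ≠ 0) (fun _ _ h => h)
  have hdeg : (∑ i : t, Finsupp.single ((i : Fin n), (σ i : Fin n)) 1).degree = t.card := by
    simp [map_sum]
  refine ⟨∑ i : t, Finsupp.single ((i : Fin n), (σ i : Fin n)) 1, ?_, ?_, ?_, ?_⟩
  · rintro ⟨a, b⟩
    rw [Finsupp.finsetSum_apply]
    by_cases hab : ∃ i : t, ((i : Fin n), (σ i : Fin n)) = (a, b)
    · obtain ⟨i, hi⟩ := hab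
      rw [Finset.sum_eq_single i]
      · rw [hi, Finsupp.single_eq_same, ← hi]
        exact Nat.one_le_iff_ne_zero.mpr ((hσ i (σ i)).mpr rfl)
      · intro k _ hk
        refine Finsupp.single_eq_of_ne fun h => hk (Subtype.ext ?_)
        exact congrArg Prod.fst (h.symm.trans hi.symm)
      · simp
    · rw [Finset.sum_eq_zero]
      · exact Nat.zero_le _
      · exact fun i _ => Finsupp.single_eq_of_ne fun h => hab ⟨i, h.symm⟩
  · intro h0
    rw [h0] at hdeg
    exact ht.card_pos.ne' (by simpa using hdeg.symm)
  · rw [map_sum]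
    simp only [Finsupp.weight_apply, Finsupp.sum_single_index, zero_smul, one_smul, torusWeight,
      Finset.sum_sub_distrib]
    rw [Equiv.sum_comp σ fun i : t => (Pi.single (i : Fin n) 1 : Fin n → ℤ), sub_self]
  · rw [hdeg]
    simpa using t.card_le_univ

/-! ### Minors and the ideal they generate -/

/-- The principal minor of the generic matrix with rows and columns in `I`. -/
noncomputable def genericMinor (n : ℕ) (I : Finset (Fin n)) : MvPolynomial (Fin n × Fin n) ℂ :=
  ((Matrix.mvPolynomialX (Fin n) (Fin n) ℂ).submatrix
    (Subtype.val : I → Fin n) (Subtype.val : I → Fin n)).det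

theorem aeval_genericMinor (a : Fin n × Fin n → ℂ) (I : Finset (Fin n)) :
    aeval a (genericMinor n I) =
      affinePrincipalMinorMap n (Matrix.of fun i j => a (i, j)) I := by
  rw [genericMinor, AlgHom.map_det, affinePrincipalMinorMap]
  congr 1
  ext i j
  simp

theorem isWeightedHomogeneous_genericMinor {M : Type*} [AddCommMonoid M]
    (w : Fin n × Fin n → M) (u v : Fin n → M) (hw : ∀ i j, w (i, j) = u i + v j)
    (I : Finset (Fin n)) :
    IsWeightedHomogeneous w (genericMinor n I) (∑ i ∈ I, (u i + v i)) := by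
  rw [genericMinor, Matrix.det_apply]
  refine IsWeightedHomogeneous.sum _ _ _ fun σ _ => ?_
  have hprod : IsWeightedHomogeneous w
      (∏ i : I, (X ((σ i : Fin n), (i : Fin n)) : MvPolynomial (Fin n × Fin n) ℂ))
      (∑ i ∈ I, (u i + v i)) := by
    convert IsWeightedHomogeneous.prod Finset.univ
      (fun i : I => (X ((σ i : Fin n), (i : Fin n)) : MvPolynomial (Fin n × Fin n) ℂ))
      (fun i => w (σ i, i)) (fun i _ => isWeightedHomogeneous_X ℂ w _) using 1
    simp only [hw, Finset.sum_add_distrib]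
    rw [Equiv.sum_comp σ fun i : I => u i, Finset.sum_coe_sort I u, Finset.sum_coe_sort I v]
  rcases Int.units_eq_one_or (Equiv.Perm.sign σ) with hs | hs
  · simpa [hs] using hprod
  · simpa [hs] using hprod.neg

theorem isWeightedHomogeneous_torusWeight_genericMinor (I : Finset (Fin n)) :
    IsWeightedHomogeneous (torusWeight n) (genericMinor n I) 0 := by
  convert isWeightedHomogeneous_genericMinor (torusWeight n) (fun i => Pi.single i 1)
    (fun j => -Pi.single j 1) (fun i j => sub_eq_add_neg _ _) I using 1
  simp

theorem isWeightedHomogeneous_gradedTorusWeight_genericMinor (I : Finset (Fin n)) :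
    IsWeightedHomogeneous (gradedTorusWeight n) (genericMinor n I) (0, (I.card : ℤ)) := by
  convert isWeightedHomogeneous_genericMinor (gradedTorusWeight n) (fun i => (Pi.single i 1, 1))
    (fun j => (-Pi.single j 1, 0))
    (fun i j => by simp [gradedTorusWeight, torusWeight, sub_eq_add_neg]) I using 1
  rw [Prod.ext_iff, Prod.fst_sum, Prod.snd_sum]
  simp

theorem weightedHomogeneousComponent_mul {σ R M : Type*} [CommSemiring R] [AddCommGroup M]
    {w : σ → M} {p : MvPolynomial σ R} {d : M} (hp : IsWeightedHomogeneous w p d) (k : M)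
    (q : MvPolynomial σ R) :
    weightedHomogeneousComponent w k (p * q) = p * weightedHomogeneousComponent w (k - d) q := by
  classical
  induction q using MvPolynomial.induction_on' with
  | monomial u a =>
    have hu := isWeightedHomogeneous_monomial w u a rfl
    rw [weightedHomogeneousComponent_of_mem (hp.mul hu), weightedHomogeneousComponent_of_mem hu]
    by_cases hk : k = d + Finsupp.weight w u
    · rw [if_pos hk, if_pos (by rw [hk, add_sub_cancel_left])]
    · rw [if_neg hk, if_neg (fun h => hk (by rw [← h, add_sub_cancel])), mul_zero]
  | add q r hq hr => rw [mul_add, map_add, map_add, mul_add, hq, hr]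

/-- The ideal generated by the principal minors of positive size. -/
noncomputable def minorIdeal (n : ℕ) : Ideal (MvPolynomial (Fin n × Fin n) ℂ) :=
  Ideal.span (Set.range fun I : {I : Finset (Fin n) // I.Nonempty} => genericMinor n I)

theorem monomial_mem_radical_minorIdeal {m : Fin n × Fin n →₀ ℕ}
    (hm : Finsupp.weight (torusWeight n) m = 0) (hm0 : m ≠ 0) :
    monomial m 1 ∈ (minorIdeal n).radical := by
  rw [← vanishingIdeal_zeroLocus_eq_radical (K := ℂ)]
  intro a ha
  by_contra hne
  rw [aeval_monomial, map_one, one_mul] at hne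
  have hsupp : ∀ i j, m (i, j) ≠ 0 → a (i, j) ≠ 0 := by
    intro i j hij h0
    refine hne (Finset.prod_eq_zero (Finsupp.mem_support_iff.mpr hij) ?_)
    simp [h0, hij]
  obtain ⟨t, ht, σ, hσ⟩ := exists_finset_perm_graph_of_weight_eq_zero hm hm0
    (fun i j => a (i, j) ≠ 0) hsupp
  have h0 := ha _ (Ideal.subset_span ⟨⟨t, ht⟩, rfl⟩)
  rw [aeval_genericMinor] at h0
  exact Matrix.det_ne_zero_of_support_eq_graph _ σ hσ h0

theorem exists_forall_monomial_mem_minorIdeal (n : ℕ) :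
    ∃ D : ℕ, ∀ m : Fin n × Fin n →₀ ℕ, Finsupp.weight (torusWeight n) m = 0 → D ≤ m.degree →
      monomial m 1 ∈ minorIdeal n := by
  obtain ⟨N, hN⟩ := Ideal.exists_radical_pow_le_of_fg (minorIdeal n)
    (IsNoetherian.noetherian _)
  have key : ∀ (k : ℕ) (m : Fin n × Fin n →₀ ℕ), Finsupp.weight (torusWeight n) m = 0 →
      (n + 1) * k ≤ m.degree → monomial m (1 : ℂ) ∈ (minorIdeal n).radical ^ k := by
    intro k
    induction k with
    | zero => simp
    | succ k ih =>
      intro m hm hk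
      -- The factor `n + 1`, rather than `n`, forces this even for `n = 0`.
      have hm0 : m ≠ 0 := by
        rintro rfl
        rw [map_zero] at hk
        exact absurd hk (by simp)
      obtain ⟨c, hcm, hc0, hc, hcn⟩ := exists_le_degree_le hm hm0
      obtain ⟨r, rfl⟩ := exists_add_of_le hcm
      rw [map_add, hc, zero_add] at hm
      rw [map_add, mul_add, mul_one] at hk
      have hmul : monomial (c + r) (1 : ℂ) = monomial r 1 * monomial c 1 := by
        rw [monomial_mul, one_mul, add_comm]
      rw [hmul, pow_succ]
      exact Ideal.mul_mem_mul (ih r hm (by omega)) (monomial_mem_radical_minorIdeal hc hc0)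
  exact ⟨(n + 1) * N, fun m hm hD => hN (key N m hm hD)⟩

/-! ### Finiteness of the invariants -/

/-- The comorphism of the affine principal minor map. -/
noncomputable def minorHom (n : ℕ) :
    MvPolynomial (Finset (Fin n)) ℂ →ₐ[ℂ] MvPolynomial (Fin n × Fin n) ℂ :=
  aeval (genericMinor n)

theorem aeval_minorHom (a : Fin n × Fin n → ℂ) (f : MvPolynomial (Finset (Fin n)) ℂ) :
    aeval a (minorHom n f) =
      aeval (affinePrincipalMinorMap n (Matrix.of fun i j => a (i, j))) f := by
  induction f using MvPolynomial.induction_on with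
  | C c => simp [minorHom]
  | add p q hp hq => rw [map_add, map_add, map_add, hp, hq]
  | mul_X p I hp =>
    rw [map_mul, map_mul, map_mul, hp, aeval_X, minorHom, aeval_X, aeval_genericMinor]

theorem isWeightedHomogeneous_minorHom (f : MvPolynomial (Finset (Fin n)) ℂ) :
    IsWeightedHomogeneous (torusWeight n) (minorHom n f) 0 := by
  induction f using MvPolynomial.induction_on with
  | C c => simpa [minorHom, algebraMap_eq] using isWeightedHomogeneous_C (torusWeight n) c
  | add p q hp hq => rw [map_add]; exact hp.add hq
  | mul_X p I hp =>
    rw [map_mul]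
    simpa [minorHom] using hp.mul (isWeightedHomogeneous_torusWeight_genericMinor I)

/-- Polynomials in the matrix entries as an algebra over polynomials in the principal minors. -/
noncomputable abbrev minorAlgebra (n : ℕ) :
    Algebra (MvPolynomial (Finset (Fin n)) ℂ) (MvPolynomial (Fin n × Fin n) ℂ) :=
  (minorHom n).toRingHom.toAlgebra

section

attribute [local instance] minorAlgebra

theorem minor_smul_def (f : MvPolynomial (Finset (Fin n)) ℂ)
    (q : MvPolynomial (Fin n × Fin n) ℂ) : f • q = minorHom n f * q :=
  rfl

/-- The torus-invariant polynomials, as a module over the polynomials in the principal minors. -/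
noncomputable def invariants (n : ℕ) :
    Submodule (MvPolynomial (Finset (Fin n)) ℂ) (MvPolynomial (Fin n × Fin n) ℂ) where
  carrier := {q | IsWeightedHomogeneous (torusWeight n) q 0}
  zero_mem' := isWeightedHomogeneous_zero ℂ _ _
  add_mem' := fun hp hq => IsWeightedHomogeneous.add hp hq
  smul_mem' := fun f q hq => by
    have h := (isWeightedHomogeneous_minorHom f).mul hq
    rwa [add_zero] at h

theorem mem_of_monomial_mem
    (N : Submodule (MvPolynomial (Finset (Fin n)) ℂ) (MvPolynomial (Fin n × Fin n) ℂ))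
    (q : MvPolynomial (Fin n × Fin n) ℂ) (h : ∀ m ∈ q.support, monomial m 1 ∈ N) : q ∈ N := by
  rw [q.as_sum]
  refine N.sum_mem fun m hm => ?_
  have hs := N.smul_mem (C (coeff m q)) (h m hm)
  rwa [minor_smul_def, minorHom, algHom_C, algebraMap_eq, C_mul_monomial, mul_one] at hs

theorem fg_invariants (n : ℕ) : (invariants n).FG := by
  obtain ⟨D, hD⟩ := exists_forall_monomial_mem_minorIdeal n
  let B : Set (MvPolynomial (Fin n × Fin n) ℂ) :=
    (fun m => monomial m 1) '' {m | Finsupp.weight (torusWeight n) m = 0 ∧ m.degree < D}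
  have hfin : B.Finite := by
    refine Set.Finite.image _ ((Finsupp.finite_of_degree_le D).subset ?_)
    exact fun m hm => hm.2.le
  have key : ∀ (d : ℕ) (m : Fin n × Fin n →₀ ℕ), Finsupp.weight (torusWeight n) m = 0 →
      m.degree = d →
      monomial m 1 ∈ Submodule.span (MvPolynomial (Finset (Fin n)) ℂ) B := by
    intro d
    induction d using Nat.strong_induction_on with
    | _ d ih =>
      intro m hm hd
      by_cases hlt : d < D
      · exact Submodule.subset_span ⟨m, ⟨hm, hd ▸ hlt⟩, rfl⟩
      obtain ⟨f, hf⟩ := (Ideal.mem_span_range_iff_exists_fun).mp (hD m hm (by omega))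
      have hmon : weightedHomogeneousComponent (gradedTorusWeight n) (0, (d : ℤ))
          (monomial m (1 : ℂ)) = monomial m 1 :=
        (isWeightedHomogeneous_monomial _ _ _
          (by rw [weight_gradedTorusWeight, hm, hd])).weightedHomogeneousComponent_same
      -- Taking the graded component makes the coefficient of each minor invariant of degree `d -
      -- |I|`, which is smaller than `d`.
      rw [← hmon, ← hf, map_sum]
      refine Submodule.sum_mem _ fun I _ => ?_
      rw [mul_comm, weightedHomogeneousComponent_mul
        (isWeightedHomogeneous_gradedTorusWeight_genericMinor I.1)]
      have hX : minorHom n (X I.1) = genericMinor n I.1 := by rw [minorHom, aeval_X]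
      rw [← hX, ← minor_smul_def]
      refine Submodule.smul_mem _ _ (mem_of_monomial_mem _ _ fun m' hm' => ?_)
      have hw := weightedHomogeneousComponent_isWeightedHomogeneous _ _
        (mem_support_iff.mp hm')
      rw [weight_gradedTorusWeight, Prod.ext_iff] at hw
      have hpos := I.2.card_pos
      have h2 : (m'.degree : ℤ) = d - I.1.card := hw.2
      exact ih m'.degree (by omega) m' (by simpa using hw.1) rfl
  refine Submodule.fg_def.mpr ⟨B, hfin, le_antisymm (Submodule.span_le.mpr ?_) ?_⟩
  · rintro _ ⟨m, hm, rfl⟩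
    exact isWeightedHomogeneous_monomial _ _ _ hm.1
  · exact fun q hq => mem_of_monomial_mem _ _ fun m hm =>
      key _ m (hq (mem_support_iff.mp hm)) rfl

theorem one_notMem_map_minorHom {p : Finset (Fin n) → ℂ}
    (hp : p ∈ zeroLocus ℂ (RingHom.ker (minorHom n))) :
    (1 : MvPolynomial (Fin n × Fin n) ℂ) ∉ (vanishingIdeal ℂ {p}).map (minorHom n) := by
  intro h1
  -- The weight-zero projection is a Reynolds operator, linear over the minors.
  have hρ : ∀ q ∈ (vanishingIdeal ℂ {p}).map (minorHom n), ∀ r ∈ invariants n,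
      weightedHomogeneousComponent (torusWeight n) 0 q * r ∈
        vanishingIdeal ℂ {p} • invariants n := by
    intro q hq r hr
    refine Submodule.closure_induction (p := fun q _ =>
      weightedHomogeneousComponent (torusWeight n) 0 q * r ∈
        vanishingIdeal ℂ {p} • invariants n) ?_ ?_ ?_ hq
    · rw [map_zero, zero_mul]
      exact zero_mem _
    · intro q q' _ _ hq hq'
      rw [map_add, add_mul]
      exact add_mem hq hq'
    · rintro s _ ⟨f, hf, rfl⟩
      rw [smul_eq_mul, mul_comm s]
      have hmul := weightedHomogeneousComponent_mul (isWeightedHomogeneous_minorHom f) 0 s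
      rw [sub_zero] at hmul
      erw [hmul]
      rw [mul_assoc]
      have hinv := (weightedHomogeneousComponent_isWeightedHomogeneous
        (w := torusWeight n) 0 s).mul hr
      rw [add_zero] at hinv
      exact Submodule.smul_mem_smul hf hinv
  obtain ⟨s, hs, hs0⟩ := Submodule.exists_sub_one_mem_and_smul_eq_zero_of_fg_of_le_smul
    (vanishingIdeal ℂ {p}) (invariants n) (fg_invariants n) (fun r hr => by
      have h := hρ 1 h1 r hr
      rwa [(isWeightedHomogeneous_one ℂ (torusWeight n)).weightedHomogeneousComponent_same,
        one_mul] at h)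
  -- Since `s` kills `1`, it lies in the kernel and vanishes at `p`, yet `s` is `1` there.
  have hker := hs0 1 (isWeightedHomogeneous_one ℂ (torusWeight n))
  rw [minor_smul_def, mul_one] at hker
  have h0 := hs p rfl
  rw [map_sub, hp s hker, map_one] at h0
  norm_num at h0

end

/-! ### The image as a zero locus -/

theorem range_affinePrincipalMinorMap (n : ℕ) :
    Set.range (affinePrincipalMinorMap n) = zeroLocus ℂ (RingHom.ker (minorHom n)) := by
  ext p
  constructor
  · rintro ⟨A, rfl⟩ f hf
    have h := aeval_minorHom (fun e : Fin n × Fin n => A e.1 e.2) f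
    rw [RingHom.mem_ker.mp hf, map_zero] at h
    exact h.symm
  · intro hp
    obtain ⟨Q, hQ, hle⟩ := Ideal.exists_le_maximal _
      ((Ideal.ne_top_iff_one _).mpr (one_notMem_map_minorHom hp))
    obtain ⟨a, rfl⟩ := isMaximal_iff_eq_vanishingIdeal_singleton.mp hQ
    refine ⟨Matrix.of fun i j => a (i, j), funext fun I => ?_⟩
    have hI : X I - C (p I) ∈ vanishingIdeal ℂ {p} := by
      rw [mem_vanishingIdeal_singleton_iff]
      simp
    have h := hle (Ideal.mem_map_of_mem (minorHom n) hI) a rfl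
    rw [aeval_minorHom] at h
    simpa [sub_eq_zero] using h

theorem isClosed_zeroLocus {σ : Type*} (J : Ideal (MvPolynomial σ ℂ)) :
    IsClosed (zeroLocus ℂ J) := by
  have h : zeroLocus ℂ J = ⋂ p ∈ J, {x | eval x p = 0} := by
    ext x
    simp [aeval_eq_eval]
  rw [h]
  exact isClosed_biInter fun p _ => isClosed_eq (MvPolynomial.continuous_eval p) continuous_const

end PrincipalMinor

theorem theorem1 (n : ℕ) :
    IsClosed (Set.range (affinePrincipalMinorMap n)) ∧
      ∃ J : Ideal (MvPolynomial (Finset (Fin n)) ℂ),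
        Set.range (affinePrincipalMinorMap n) = MvPolynomial.zeroLocus ℂ J := by
  rw [PrincipalMinor.range_affinePrincipalMinorMap]
  exact ⟨PrincipalMinor.isClosed_zeroLocus _, _, rfl⟩
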